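/- Let $z$ be a real quadratic irrational, i.e. an irrational real root of a quadratic polynomial with integer coefficients. The regular continued fraction expansion $z=\lfloor a_0,a_1,a_2,\ldots\rfloor$ is defined by $z_0=z$, $a_j=\lfloor z_j\rfloor$, $z_{j+1}=1/(z_j-a_j)$ for $j\ge 0$, and its convergents $p_k/q_k$ by $p_{-1}=1$, $q_{-1}=0$, $p_0=a_0$, $q_0=1$, $p_{k+1}=a_{k+1}p_k+p_{k-1}$, $q_{k+1}=a_{k+1}q_k+q_{k-1}$ for $k\ge 0$. The negative regular continued fraction expansion $z=\lceil c_0,c_1,c_2,\ldots\rceil$ is defined by $z_0=z$, $c_j=\lceil z_j\rceil$, $z_{j+1}=1/(c_j-z_j)$ for $j\ge 0$, and its convergents $s_j/t_j$ by $s_{-1}=1$, $t_{-1}=0$, $s_0=c_0$, $t_0=1$, $s_{j+1}=c_{j+1}s_j-s_{j-1}$, $t_{j+1}=c_{j+1}t_j-t_{j-1}$ for $j\ge 0$. Both expansions are eventually periodic: $$z=\lfloor a_0,\ldots,a_q,\overline{b_1,\ldots,b_l}\rfloor=\lceil c_0,\ldots,c_r,\overline{d_1,\ldots,d_m}\rceil,$$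 where $l,m\ge 1$ are chosen smallest possible and then $q,r\ge -1$ are chosen smallest possible (so $q=-1$, respectively $r=-1$, in the purely periodic case). Let $L=l$ if $l$ is even and $L=2l$ if $l$ is odd, where the $b_j$ are continued periodically, $b_{j+l}=b_j$, and put $$B=(-1)^q\sum_{j=1}^{L}(-1)^{j-1}b_j,\qquad D=\frac1m\sum_{j=1}^m d_j .$$ For an integer $a$ and a positive integer $b$ let $S(a,b)=12\sum_{k=1}^{b}((k/b))((ak/b))$, where $((x))=x-\lfloor x\rfloor-1/2$ if $x\in\mathbb R\setminus\mathbb Z$ and $((x))=0$ if $x\in\mathbb Z$. Then $B>0$ if and only if $D<3$, $B=0$ if and only if $D=3$, and $B<0$ if and only if $D>3$. Moreover: - if $B>0$ (equivalently $D<3$), then $S(p_k,q_k)\to+\infty$ as $k\to\infty$ and $S(s_j,t_j)\to+\infty$ as $j\to\infty$; - if $B=0$ (equivalently $D=3$), then the sequences $S(p_k,q_k)$, $k\ge 0$, and $S(s_j,t_j)$, $j\ge 0$, are bounded; - if $B<0$ (equivalently $D>3$), then $S(p_k,q_k)\to-\infty$ as $k\to\infty$ and $S(s_j,t_j)\to-\infty$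 as $j\to\infty$. -/

import Mathlib

/-- A real quadratic irrational: an irrational real root of a quadratic polynomial
with integer coefficients. -/
def IsQuadraticIrrational (z : ℝ) : Prop :=
  Irrational z ∧ ∃ a b c : ℤ, a ≠ 0 ∧ (a : ℝ) * z ^ 2 + (b : ℝ) * z + (c : ℝ) = 0

/-! ### The regular continued fraction expansion -/

/-- Complete quotients of the regular expansion: `z₀ = z`, `z_{j+1} = 1 / (z_j - ⌊z_j⌋)`. -/
noncomputable def regQuot (z : ℝ) : ℕ → ℝ
  | 0 => z
  | j + 1 => 1 / (regQuot z j - (⌊regQuot z j⌋ : ℝ))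

/-- Partial quotients `a_j = ⌊z_j⌋` of the regular expansion. -/
noncomputable def regCoeff (z : ℝ) (j : ℕ) : ℤ := ⌊regQuot z j⌋

/-- Numerators `p_k` of the regular convergents; here `p_{-1} = 1`. -/
noncomputable def regNum (z : ℝ) : ℕ → ℤ
  | 0 => regCoeff z 0
  | 1 => regCoeff z 1 * regCoeff z 0 + 1
  | k + 2 => regCoeff z (k + 2) * regNum z (k + 1) + regNum z k

/-- Denominators `q_k` of the regular convergents; here `q_{-1} = 0`. -/
noncomputable def regDen (z : ℝ) : ℕ → ℤ
  | 0 => 1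
  | 1 => regCoeff z 1 * 1 + 0
  | k + 2 => regCoeff z (k + 2) * regDen z (k + 1) + regDen z k

/-! ### The negative regular continued fraction expansion -/

/-- Complete quotients of the negative regular expansion:
`z₀ = z`, `z_{j+1} = 1 / (⌈z_j⌉ - z_j)`. -/
noncomputable def negQuot (z : ℝ) : ℕ → ℝ
  | 0 => z
  | j + 1 => 1 / ((⌈negQuot z j⌉ : ℝ) - negQuot z j)

/-- Partial quotients `c_j = ⌈z_j⌉` of the negative regular expansion. -/
noncomputable def negCoeff (z : ℝ) (j : ℕ) : ℤ := ⌈negQuot z j⌉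

/-- Numerators `s_j` of the negative regular convergents; here `s_{-1} = 1`. -/
noncomputable def negNum (z : ℝ) : ℕ → ℤ
  | 0 => negCoeff z 0
  | 1 => negCoeff z 1 * negCoeff z 0 - 1
  | j + 2 => negCoeff z (j + 2) * negNum z (j + 1) - negNum z j

/-- Denominators `t_j` of the negative regular convergents; here `t_{-1} = 0`. -/
noncomputable def negDen (z : ℝ) : ℕ → ℤ
  | 0 => 1
  | 1 => negCoeff z 1 * 1 - 0
  | j + 2 => negCoeff z (j + 2) * negDen z (j + 1) - negDen z j

/-! ### Dedekind sums -/

open Classical in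
/-- The function `((x))`. -/
noncomputable def sawtooth (x : ℝ) : ℝ :=
  if ∃ n : ℤ, x = (n : ℝ) then 0 else x - (⌊x⌋ : ℝ) - 1 / 2

/-- The normalized Dedekind sum `S(a, b) = 12 s(a, b)`, for an integer `a` and a positive
integer `b`. -/
noncomputable def dedekindS (a b : ℤ) : ℝ :=
  12 * ∑ k ∈ Finset.Icc 1 b,
    sawtooth ((k : ℝ) / (b : ℝ)) * sawtooth ((a : ℝ) * (k : ℝ) / (b : ℝ))

/-! ### Periods -/

/-- `l ≥ 1` is a period of the sequence `x` from the index `N` on. -/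
def IsPeriodFrom (x : ℕ → ℤ) (N l : ℕ) : Prop :=
  0 < l ∧ ∀ n, N ≤ n → x (n + l) = x n

/-- The sequence `x` is eventually periodic. -/
def EventuallyPeriodic (x : ℕ → ℤ) : Prop := ∃ N l, IsPeriodFrom x N l

/-- The smallest period length of an eventually periodic sequence. -/
noncomputable def periodLength (x : ℕ → ℤ) : ℕ := sInf {l | ∃ N, IsPeriodFrom x N l}

/-- The smallest possible length of the part preceding the period, for the smallest period
length.  It is `0` exactly in the purely periodic case. -/
noncomputable def preperiodLength (x : ℕ → ℤ) : ℕ :=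
  sInf {N | IsPeriodFrom x N (periodLength x)}

/-- The smallest even period length `L` of the regular expansion: `l` if `l` is even and `2 l`
if `l` is odd, where `l` is the smallest period length. -/
noncomputable def evenPeriodLength (z : ℝ) : ℕ :=
  if Even (periodLength (regCoeff z)) then periodLength (regCoeff z)
  else 2 * periodLength (regCoeff z)

/-- `B = (-1)^q ∑_{j=1}^{L} (-1)^{j-1} b_j`, where `z = ⌊a_0, …, a_q, b_1, …, b_l, b_1, …⌋`, with
`q = -1` in the purely periodic case; so `q + 1` is the preperiod length,
`b_j = a_{q + 1 + (j - 1)}`, and `(-1)^q = (-1)^{(q + 1) + 1}`. -/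
noncomputable def altSumB (z : ℝ) : ℤ :=
  (-1 : ℤ) ^ (preperiodLength (regCoeff z) + 1) *
    ∑ j ∈ Finset.Icc 1 (evenPeriodLength z),
      (-1 : ℤ) ^ (j - 1) * regCoeff z (preperiodLength (regCoeff z) + (j - 1))

/-- `D = (1 / m) ∑_{j=1}^{m} d_j`, where `z = ⌈c_0, …, c_r, d_1, …, d_m, d_1, …⌉`, with `r = -1` in
the purely periodic case; so `r + 1` is the preperiod length and `d_j = c_{r + 1 + (j - 1)}`. -/
noncomputable def meanD (z : ℝ) : ℚ :=
  (∑ j ∈ Finset.Icc 1 (periodLength (negCoeff z)),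
      (negCoeff z (preperiodLength (negCoeff z) + (j - 1)) : ℚ)) /
    (periodLength (negCoeff z) : ℚ)

/-! Along either expansion the Dedekind sum is, up to a bounded error, a partial sum of a simple
sequence. The determinant of consecutive convergents makes the numerator inverse, up to sign, to the
previous denominator, and `dedekindS_eq_of_mul_modEq_one` says that inverse residues have equal
sums. The reciprocity law and reduction of the larger denominator modulo the smaller then give a
recursion in which everything but the partial quotient telescopes. Hence S(p_k, q_k) = ∑_{j ≤ k}
(-1)^(j+1) a_j + O(1) and S(s_k, t_k) = ∑_{j ≤ k} (3 - c_j) + O(1).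

Partial sums of an eventually periodic sequence grow linearly, with slope the mean over a period:
here B / L and 3 - D. The sign of the slope decides between the three kinds of behavior.

That B and 3 - D have the same sign follows from the conversion of expansions: a pair a_{2n},
a_{2n+1} turns into one coefficient, a_{2n} + 2 (a_0 + 1 for n = 0), followed by a_{2n+1} - 1 twos.
So the two partial sums differ by exactly 1 along suitable indices (`sum_range_negIndex_succ`).
Periodicity is Lagrange's theorem for the regular expansion, and is carried over to the negative one
by the same conversion. -/

/-! ### Sawtooth function and symmetries of Dedekind sums -/

theorem sawtooth_intCast (n : ℤ) : sawtooth (n : ℝ) = 0 := by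
  unfold sawtooth
  rw [if_pos ⟨n, rfl⟩]

theorem sawtooth_add_intCast (x : ℝ) (n : ℤ) : sawtooth (x + n) = sawtooth x := by
  unfold sawtooth
  have h : (∃ m : ℤ, x + n = (m : ℝ)) ↔ ∃ m : ℤ, x = (m : ℝ) := by
    constructor
    · rintro ⟨m, hm⟩
      exact ⟨m - n, by push_cast; linarith⟩
    · rintro ⟨m, hm⟩
      exact ⟨m + n, by push_cast; linarith⟩
  by_cases hx : ∃ m : ℤ, x = (m : ℝ)
  · rw [if_pos hx, if_pos (h.2 hx)]
  · rw [if_neg hx, if_neg fun e => hx (h.1 e), Int.floor_add_intCast]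
    push_cast; ring

theorem sawtooth_neg (x : ℝ) : sawtooth (-x) = -sawtooth x := by
  by_cases h : ∃ m : ℤ, x = (m : ℝ)
  · obtain ⟨m, rfl⟩ := h
    rw [← Int.cast_neg, sawtooth_intCast, sawtooth_intCast, neg_zero]
  · have h' : ¬ ∃ m : ℤ, -x = (m : ℝ) := by
      rintro ⟨m, hm⟩
      exact h ⟨-m, by push_cast; linarith⟩
    have hfl : ⌊-x⌋ = -⌊x⌋ - 1 := by
      rw [Int.floor_eq_iff]
      have h1 := Int.floor_le x
      have h2 := Int.lt_floor_add_one x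
      have h3 : (⌊x⌋ : ℝ) ≠ x := fun e => h ⟨_, e.symm⟩
      have h4 := lt_of_le_of_ne h1 h3
      push_cast
      constructor <;> linarith
    unfold sawtooth
    rw [if_neg h, if_neg h', hfl]
    push_cast; ring

theorem sawtooth_div_emod {n : ℤ} (hn : 0 < n) (m : ℤ) :
    sawtooth ((m : ℝ) / n) = sawtooth (((m % n : ℤ) : ℝ) / n) := by
  have hn' : (n : ℝ) ≠ 0 := by exact_mod_cast hn.ne'
  have h : (m : ℝ) / n = ((m % n : ℤ) : ℝ) / n + ((m / n : ℤ) : ℝ) := by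
    have : (m : ℝ) = ((m % n : ℤ) : ℝ) + (n : ℝ) * ((m / n : ℤ) : ℝ) := by
      exact_mod_cast (Int.emod_add_mul_ediv m n).symm
    field_simp
    linarith
  rw [h, sawtooth_add_intCast]

theorem sawtooth_div_of_lt {n r : ℤ} (h0 : 0 < r) (h1 : r < n) :
    sawtooth ((r : ℝ) / n) = (r : ℝ) / n - 1 / 2 := by
  have hn : (0 : ℝ) < n := by exact_mod_cast h0.trans h1
  have h0' : (0 : ℝ) < r := by exact_mod_cast h0
  have h1' : (r : ℝ) < n := by exact_mod_cast h1
  have hpos : 0 < (r : ℝ) / n := by positivity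
  have hlt : (r : ℝ) / n < 1 := by rwa [div_lt_one hn]
  unfold sawtooth
  rw [if_neg, Int.floor_eq_zero_iff.2 ⟨hpos.le, hlt⟩]
  · simp
  · rintro ⟨m, hm⟩
    rw [hm] at hpos hlt
    have h3 : 0 < m := by exact_mod_cast hpos
    have h4 : m < 1 := by exact_mod_cast hlt
    omega

/-- The terms k = 0 and k = n both vanish. The new range is the set of remainders modulo n, ready
for reindexing by a unit. -/
theorem dedekindS_eq_sum_Ico {n : ℤ} (hn : 0 < n) (a : ℤ) :
    dedekindS a n = 12 * ∑ k ∈ Finset.Ico 0 n,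
      sawtooth ((k : ℝ) / n) * sawtooth (((a * k : ℤ) : ℝ) / n) := by
  unfold dedekindS
  have e1 : Finset.Icc 1 n = insert n (Finset.Ioo 0 n) := by
    ext x; simp only [Finset.mem_Icc, Finset.mem_insert, Finset.mem_Ioo]; omega
  have e2 : Finset.Ico 0 n = insert 0 (Finset.Ioo 0 n) := by
    ext x; simp only [Finset.mem_Ico, Finset.mem_insert, Finset.mem_Ioo]; omega
  have hn' : (n : ℝ) ≠ 0 := by exact_mod_cast hn.ne'
  rw [e1, e2, Finset.sum_insert (by simp), Finset.sum_insert (by simp)]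
  have h1 : sawtooth ((n : ℝ) / n) = 0 := by
    rw [div_self hn']; simpa using sawtooth_intCast 1
  have h2 : sawtooth (((0 : ℤ) : ℝ) / n) = 0 := by
    simpa using sawtooth_intCast 0
  rw [h1, h2]
  push_cast
  ring

theorem sum_Ico_mul_emod {n a : ℤ} (hn : 0 < n) (ha : IsCoprime a n) (g : ℤ → ℝ) :
    ∑ k ∈ Finset.Ico 0 n, g (a * k % n) = ∑ k ∈ Finset.Ico 0 n, g k := by
  have hmaps : Set.MapsTo (fun k => a * k % n) (Finset.Ico 0 n : Finset ℤ)
      (Finset.Ico 0 n : Finset ℤ) := by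
    intro k _
    simp only [Finset.coe_Ico, Set.mem_Ico]
    exact ⟨Int.emod_nonneg _ hn.ne', Int.emod_lt_of_pos _ hn⟩
  have hinj : Set.InjOn (fun k => a * k % n) (Finset.Ico 0 n : Finset ℤ) := by
    intro x hx y hy hxy
    simp only [Finset.coe_Ico, Set.mem_Ico] at hx hy
    have h1 : n ∣ a * y - a * x := Int.ModEq.dvd hxy
    rw [← mul_sub] at h1
    have h2 : n ∣ y - x := ha.symm.dvd_of_dvd_mul_left h1
    have h3 : x ≡ y [ZMOD n] := (Int.modEq_iff_dvd).2 h2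
    have h4 : x % n = y % n := h3
    rwa [Int.emod_eq_of_lt hx.1 hx.2, Int.emod_eq_of_lt hy.1 hy.2] at h4
  exact Finset.sum_nbij (fun k => a * k % n) hmaps hinj
    (Finset.surjOn_of_injOn_of_card_le _ hmaps hinj le_rfl) (fun _ _ => rfl)

theorem dedekindS_congr {n a b : ℤ} (hn : 0 < n) (h : a ≡ b [ZMOD n]) :
    dedekindS a n = dedekindS b n := by
  rw [dedekindS_eq_sum_Ico hn, dedekindS_eq_sum_Ico hn]
  congr 1
  refine Finset.sum_congr rfl fun k _ => ?_
  rw [sawtooth_div_emod hn (a * k), sawtooth_div_emod hn (b * k), (h.mul_right k).eq]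

theorem dedekindS_neg {n : ℤ} (hn : 0 < n) (a : ℤ) : dedekindS (-a) n = -dedekindS a n := by
  rw [dedekindS_eq_sum_Ico hn, dedekindS_eq_sum_Ico hn, ← mul_neg, ← Finset.sum_neg_distrib]
  congr 1
  refine Finset.sum_congr rfl fun k _ => ?_
  rw [neg_mul, Int.cast_neg, neg_div, sawtooth_neg, mul_neg]

/-- Substituting b * k for k swaps the two sawtooth factors. -/
theorem dedekindS_eq_of_mul_modEq_one {n a b : ℤ} (hn : 0 < n) (h : a * b ≡ 1 [ZMOD n]) :
    dedekindS a n = dedekindS b n := by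
  have hb : IsCoprime b n := by
    obtain ⟨c, hc⟩ := h.dvd
    exact ⟨a, c, by linarith⟩
  rw [dedekindS_eq_sum_Ico hn, dedekindS_eq_sum_Ico hn,
    ← sum_Ico_mul_emod hn hb
      (fun k => sawtooth ((k : ℝ) / n) * sawtooth (((a * k : ℤ) : ℝ) / n))]
  congr 1
  refine Finset.sum_congr rfl fun k _ => ?_
  have h1 : a * (b * k % n) % n = k % n := by
    rw [Int.mul_emod, Int.emod_emod_of_dvd _ dvd_rfl, ← Int.mul_emod, ← mul_assoc]
    simpa using (h.mul_right k).eq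
  rw [← sawtooth_div_emod hn (b * k), sawtooth_div_emod hn (a * (b * k % n)), h1,
    ← sawtooth_div_emod hn k, mul_comm]

/-! ### The reciprocity law -/

theorem sum_Ico_cast {n : ℤ} (hn : 0 ≤ n) :
    ∑ k ∈ Finset.Ico 0 n, (k : ℝ) = n * (n - 1) / 2 := by
  induction n, hn using Int.leInduction with
  | base => simp
  | succ m hm ih =>
    rw [← Finset.insert_Ico_right_eq_Ico_add_one hm, Finset.sum_insert (by simp), ih]
    push_cast; ring

theorem sum_Ico_cast_sq {n : ℤ} (hn : 0 ≤ n) :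
    ∑ k ∈ Finset.Ico 0 n, (k : ℝ) ^ 2 = n * (n - 1) * (2 * n - 1) / 6 := by
  induction n, hn using Int.leInduction with
  | base => simp
  | succ m hm ih =>
    rw [← Finset.insert_Ico_right_eq_Ico_add_one hm, Finset.sum_insert (by simp), ih]
    push_cast; ring

theorem cast_mul_emod (a k n : ℤ) :
    ((a * k % n : ℤ) : ℝ) = a * k - n * ((a * k / n : ℤ) : ℝ) := by
  have := Int.emod_add_mul_ediv (a * k) n
  have h : ((a * k % n : ℤ) : ℝ) + n * ((a * k / n : ℤ) : ℝ) = a * k := by exact_mod_cast this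
  linarith

theorem sum_floor {a n : ℤ} (hn : 0 < n) (h : IsCoprime a n) :
    ∑ k ∈ Finset.Ico 0 n, ((a * k / n : ℤ) : ℝ) = (a - 1) * (n - 1) / 2 := by
  have hn' : (n : ℝ) ≠ 0 := by exact_mod_cast hn.ne'
  have h1 := sum_Ico_mul_emod hn h (fun k => (k : ℝ))
  simp only [cast_mul_emod, Finset.sum_sub_distrib, ← Finset.mul_sum, sum_Ico_cast hn.le] at h1
  apply mul_left_cancel₀ hn'
  linarith

/-- The remainders a * k - n * ⌊a * k / n⌋ permute 0, …, n - 1; this compares the sums of their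
squares. -/
theorem sum_floor_sq {a n : ℤ} (hn : 0 < n) (h : IsCoprime a n) :
    (a : ℝ) ^ 2 * (n * (n - 1) * (2 * n - 1) / 6)
      - 2 * a * n * ∑ k ∈ Finset.Ico 0 n, (k : ℝ) * ((a * k / n : ℤ) : ℝ)
      + n ^ 2 * ∑ k ∈ Finset.Ico 0 n, ((a * k / n : ℤ) : ℝ) ^ 2
      = n * (n - 1) * (2 * n - 1) / 6 := by
  have h1 := sum_Ico_mul_emod hn h (fun k => (k : ℝ) ^ 2)
  rw [← sum_Ico_cast_sq hn.le]
  conv_rhs => rw [← h1]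
  rw [Finset.mul_sum, Finset.mul_sum, Finset.mul_sum,
    ← Finset.sum_sub_distrib, ← Finset.sum_add_distrib]
  refine Finset.sum_congr rfl fun k _ => ?_
  simp only [cast_mul_emod]
  ring

theorem dedekindS_eq_floor_sum {a n : ℤ} (hn : 0 < n) (h : IsCoprime a n) :
    dedekindS a n = 12 * (a * ((n - 1) * (2 * n - 1) / (6 * n))
      - (∑ k ∈ Finset.Ico 0 n, (k : ℝ) * ((a * k / n : ℤ) : ℝ)) / n - (n - 1) / 4) := by
  have hn' : (n : ℝ) ≠ 0 := by exact_mod_cast hn.ne'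
  have e2 : Finset.Ico 0 n = insert 0 (Finset.Ioo 0 n) := by
    ext x; simp only [Finset.mem_Ico, Finset.mem_insert, Finset.mem_Ioo]; omega
  -- The linear formula for the sawtooth fails only at k = 0, where it yields (-1/2)² in place of 0.
  have key : ∑ k ∈ Finset.Ico 0 n, sawtooth ((k : ℝ) / n) * sawtooth (((a * k : ℤ) : ℝ) / n)
      = ∑ k ∈ Finset.Ico 0 n, ((k : ℝ) / n - 1 / 2) * (((a * k % n : ℤ) : ℝ) / n - 1 / 2)
        - 1 / 4 := by
    rw [e2, Finset.sum_insert (by simp), Finset.sum_insert (by simp)]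
    have h2 : sawtooth (((0 : ℤ) : ℝ) / n) = 0 := by
      simpa using sawtooth_intCast 0
    rw [h2]
    have h3 : ∑ k ∈ Finset.Ioo 0 n, sawtooth ((k : ℝ) / n) * sawtooth (((a * k : ℤ) : ℝ) / n)
      = ∑ k ∈ Finset.Ioo 0 n, ((k : ℝ) / n - 1 / 2) * (((a * k % n : ℤ) : ℝ) / n - 1 / 2) := by
      refine Finset.sum_congr rfl fun k hk => ?_
      rw [Finset.mem_Ioo] at hk
      have hr : 0 < a * k % n := by
        refine lt_of_le_of_ne (Int.emod_nonneg _ hn.ne') fun e => ?_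
        have h4 : n ∣ k := h.symm.dvd_of_dvd_mul_left (Int.dvd_of_emod_eq_zero e.symm)
        exact absurd (Int.le_of_dvd hk.1 h4) (by omega)
      rw [sawtooth_div_of_lt hk.1 hk.2, sawtooth_div_emod hn (a * k),
        sawtooth_div_of_lt hr (Int.emod_lt_of_pos _ hn)]
    rw [h3]
    norm_num
  have hs : ∑ k ∈ Finset.Ico 0 n, ((a * k % n : ℤ) : ℝ) = n * (n - 1) / 2 := by
    rw [← sum_Ico_cast hn.le]
    exact sum_Ico_mul_emod hn h (fun k => (k : ℝ))
  have h5 : ∀ k : ℤ, ((k : ℝ) / n - 1 / 2) * (((a * k % n : ℤ) : ℝ) / n - 1 / 2)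
      = (a / n ^ 2) * (k : ℝ) ^ 2 - (1 / n) * ((k : ℝ) * ((a * k / n : ℤ) : ℝ))
        - (1 / (2 * n)) * k - (1 / (2 * n)) * ((a * k % n : ℤ) : ℝ) + 1 / 4 := by
    intro k
    rw [cast_mul_emod]
    field_simp
    ring
  have hc : ((n.toNat : ℕ) : ℝ) = (n : ℝ) := by
    exact_mod_cast Int.toNat_of_nonneg hn.le
  rw [dedekindS_eq_sum_Ico hn, key]
  simp only [h5, Finset.sum_add_distrib, Finset.sum_sub_distrib, ← Finset.mul_sum]
  rw [hs, sum_Ico_cast hn.le, sum_Ico_cast_sq hn.le]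
  simp only [Finset.sum_const, Int.card_Ico, sub_zero, nsmul_eq_mul, hc]
  field_simp
  ring

/-- A lattice point count: m * (m + 1) is the sum of 2 * j over j ≤ m, and the order of summation
over pairs with j * b ≤ a * k is interchanged. Coprimality excludes equality when 0 < j < a. -/
theorem sum_floor_mul_floor_add_one {a b : ℤ} (ha : 0 < a) (hb : 0 < b) (h : IsCoprime a b) :
    ∑ k ∈ Finset.Ico 0 b, ((a * k / b : ℤ) : ℝ) * (((a * k / b : ℤ) : ℝ) + 1)
      = ∑ j ∈ Finset.Ico 0 a, 2 * (j : ℝ) * ((b : ℝ) - 1 - ((b * j / a : ℤ) : ℝ)) := by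
  have hL : ∀ k ∈ Finset.Ico 0 b, ((a * k / b : ℤ) : ℝ) * (((a * k / b : ℤ) : ℝ) + 1)
      = ∑ j ∈ Finset.Ico 0 a, if j * b ≤ a * k then 2 * (j : ℝ) else 0 := by
    intro k hk
    rw [Finset.mem_Ico] at hk
    have hak : 0 ≤ a * k := mul_nonneg ha.le hk.1
    have h0 : 0 ≤ a * k / b := Int.ediv_nonneg hak hb.le
    have h1 : a * k / b < a := by
      apply Int.ediv_lt_of_lt_mul hb
      exact mul_lt_mul_of_pos_left hk.2 ha
    rw [← Finset.sum_filter, ← Finset.mul_sum]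
    have e : (Finset.Ico 0 a).filter (fun j => j * b ≤ a * k) = Finset.Ico 0 (a * k / b + 1) := by
      ext j
      simp only [Finset.mem_filter, Finset.mem_Ico, ← Int.le_ediv_iff_mul_le hb]
      omega
    rw [e, sum_Ico_cast (by omega)]
    push_cast; ring
  rw [Finset.sum_congr rfl hL, Finset.sum_comm]
  refine Finset.sum_congr rfl fun j hj => ?_
  rw [Finset.mem_Ico] at hj
  -- For j = 0 the count of k would be off by one, since k = 0 gives equality, but the weight 2 * j
  -- vanishes.
  rcases hj.1.eq_or_lt with rfl | hj0
  · simp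
  rw [← Finset.sum_filter, Finset.sum_const, nsmul_eq_mul]
  have h0 : 0 ≤ b * j / a := Int.ediv_nonneg (mul_nonneg hb.le hj.1) ha.le
  have h1 : b * j / a < b := by
    apply Int.ediv_lt_of_lt_mul ha
    exact mul_lt_mul_of_pos_left hj.2 hb
  have e : (Finset.Ico 0 b).filter (fun k => j * b ≤ a * k) = Finset.Ico (b * j / a + 1) b := by
    ext k
    simp only [Finset.mem_filter, Finset.mem_Ico]
    have hne : j * b ≠ a * k := by
      intro e
      have : a ∣ j := h.dvd_of_dvd_mul_right ⟨k, e⟩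
      exact absurd (Int.le_of_dvd hj0 this) (by omega)
    have h3 : k ≤ b * j / a ↔ k * a ≤ b * j := Int.le_ediv_iff_mul_le ha
    rw [mul_comm k a, mul_comm b j] at h3
    rw [mul_comm b j] at h0 ⊢
    constructor
    · rintro ⟨h4, h5⟩
      refine ⟨?_, h4.2⟩
      by_contra h6
      have := h3.1 (by omega)
      omega
    · rintro ⟨h4, h5⟩
      refine ⟨⟨by omega, h5⟩, ?_⟩
      by_contra h6
      have := h3.2 (by omega)
      omega
  rw [e, Int.card_Ico]
  have hc : (((b - (b * j / a + 1)).toNat : ℕ) : ℝ) = ((b - (b * j / a + 1) : ℤ) : ℝ) := by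
    exact_mod_cast Int.toNat_of_nonneg (by omega)
  rw [hc]
  push_cast; ring

/-- The reciprocity law for Dedekind sums. -/
theorem dedekindS_reciprocity {a b : ℤ} (ha : 0 < a) (hb : 0 < b) (h : IsCoprime a b) :
    dedekindS a b + dedekindS b a = -3 + (a : ℝ) / b + (b : ℝ) / a + 1 / ((a : ℝ) * b) := by
  have ha' : (a : ℝ) ≠ 0 := by exact_mod_cast ha.ne'
  have hb' : (b : ℝ) ≠ 0 := by exact_mod_cast hb.ne'
  rw [dedekindS_eq_floor_sum hb h, dedekindS_eq_floor_sum ha h.symm]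
  have h1 := sum_floor hb h
  have h2 := sum_floor_sq hb h
  have h3 := sum_floor_mul_floor_add_one ha hb h
  have h4 : ∑ k ∈ Finset.Ico 0 b, ((a * k / b : ℤ) : ℝ) * (((a * k / b : ℤ) : ℝ) + 1)
      = ∑ k ∈ Finset.Ico 0 b, ((a * k / b : ℤ) : ℝ) ^ 2
        + ∑ k ∈ Finset.Ico 0 b, ((a * k / b : ℤ) : ℝ) := by
    rw [← Finset.sum_add_distrib]
    exact Finset.sum_congr rfl fun k _ => by ring
  have h5 : ∑ j ∈ Finset.Ico 0 a, 2 * (j : ℝ) * ((b : ℝ) - 1 - ((b * j / a : ℤ) : ℝ))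
      = (b - 1) * (a * (a - 1))
        - 2 * ∑ j ∈ Finset.Ico 0 a, (j : ℝ) * ((b * j / a : ℤ) : ℝ) := by
    have : (b - 1 : ℝ) * (a * (a - 1)) = 2 * (b - 1) * (a * (a - 1) / 2) := by ring
    rw [this, ← sum_Ico_cast ha.le, Finset.mul_sum, Finset.mul_sum, ← Finset.sum_sub_distrib]
    exact Finset.sum_congr rfl fun k _ => by ring
  rw [h4, h5, h1] at h3
  generalize ∑ j ∈ Finset.Ico 0 a, (j : ℝ) * ((b * j / a : ℤ) : ℝ) = X at *
  generalize ∑ k ∈ Finset.Ico 0 b, (k : ℝ) * ((a * k / b : ℤ) : ℝ) = Y at *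
  generalize ∑ k ∈ Finset.Ico 0 b, ((a * k / b : ℤ) : ℝ) ^ 2 = G at *
  -- Both mixed sums are expressed through the sum G of squared floors, which cancels in X / a + Y /
  -- b.
  have hX : X = ((b - 1) * (a * (a - 1)) - G - (a - 1) * (b - 1) / 2) / 2 := by linarith
  have hY : Y = ((a ^ 2 - 1) * (b * (b - 1) * (2 * b - 1) / 6) + b ^ 2 * G) / (2 * a * b) := by
    rw [eq_div_iff (by positivity)]
    linarith
  rw [hX, hY]
  field_simp
  ring

/-! ### The regular expansion -/

theorem regQuot_succ (z : ℝ) (j : ℕ) : regQuot z (j + 1) = 1 / (regQuot z j - (regCoeff z j : ℝ)) :=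
  rfl

theorem irrational_regQuot {z : ℝ} (hz : Irrational z) (j : ℕ) : Irrational (regQuot z j) := by
  induction j with
  | zero => exact hz
  | succ j ih =>
    rw [regQuot_succ, one_div]
    exact (ih.sub_intCast _).inv

theorem regQuot_sub_pos {z : ℝ} (hz : Irrational z) (j : ℕ) :
    0 < regQuot z j - (regCoeff z j : ℝ) := by
  have h1 : (regCoeff z j : ℝ) ≤ regQuot z j := Int.floor_le _
  have h2 := (irrational_regQuot hz j).ne_int (regCoeff z j)
  exact sub_pos.2 (lt_of_le_of_ne h1 h2.symm)

theorem one_lt_regQuot_succ {z : ℝ} (hz : Irrational z) (j : ℕ) : 1 < regQuot z (j + 1) := by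
  rw [regQuot_succ, one_lt_div (regQuot_sub_pos hz j)]
  have : regQuot z j < regCoeff z j + 1 := Int.lt_floor_add_one _
  linarith

theorem one_le_regCoeff_succ {z : ℝ} (hz : Irrational z) (j : ℕ) : 1 ≤ regCoeff z (j + 1) := by
  rw [regCoeff, Int.le_floor]
  exact_mod_cast (one_lt_regQuot_succ hz j).le

theorem regDen_pos_and_le {z : ℝ} (hz : Irrational z) (k : ℕ) :
    0 < regDen z k ∧ regDen z k ≤ regDen z (k + 1) := by
  induction k with
  | zero =>
    have := one_le_regCoeff_succ hz 0
    simp only [regDen]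
    constructor <;> linarith
  | succ k ih =>
    have h1 := one_le_regCoeff_succ hz (k + 1)
    have h2 : regDen z (k + 2) = regCoeff z (k + 2) * regDen z (k + 1) + regDen z k := rfl
    have h3 : 0 < regDen z (k + 1) := ih.1.trans_le ih.2
    refine ⟨h3, ?_⟩
    rw [h2]
    nlinarith

theorem regDen_pos {z : ℝ} (hz : Irrational z) (k : ℕ) : 0 < regDen z k :=
  (regDen_pos_and_le hz k).1

theorem regDen_le_succ {z : ℝ} (hz : Irrational z) (k : ℕ) : regDen z k ≤ regDen z (k + 1) :=
  (regDen_pos_and_le hz k).2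

theorem regNum_mul_regDen_sub (z : ℝ) (k : ℕ) :
    regNum z (k + 1) * regDen z k - regNum z k * regDen z (k + 1) = (-1) ^ k := by
  induction k with
  | zero => simp only [regNum, regDen]; ring
  | succ k ih =>
    have h1 : regNum z (k + 2) = regCoeff z (k + 2) * regNum z (k + 1) + regNum z k := rfl
    have h2 : regDen z (k + 2) = regCoeff z (k + 2) * regDen z (k + 1) + regDen z k := rfl
    rw [h1, h2, pow_succ, ← ih]
    ring

theorem isCoprime_regDen (z : ℝ) (k : ℕ) : IsCoprime (regDen z k) (regDen z (k + 1)) := by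
  have h := regNum_mul_regDen_sub z k
  have h2 : ((-1 : ℤ) ^ k) * (-1) ^ k = 1 := by rw [← mul_pow]; simp
  exact ⟨(-1) ^ k * regNum z (k + 1), -(-1) ^ k * regNum z k, by linear_combination (-1) ^ k * h + h2⟩

/-- The error terms `q_k z - p_k` of the convergents. -/
theorem regDen_mul_sub_succ {z : ℝ} (hz : Irrational z) (k : ℕ) :
    (regDen z k * z - regNum z k : ℝ)
      = -regQuot z (k + 2) * (regDen z (k + 1) * z - regNum z (k + 1)) := by
  have hq (j : ℕ) : regQuot z (j + 1) * (regQuot z j - regCoeff z j) = 1 := by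
    rw [regQuot_succ, one_div, inv_mul_cancel₀ (regQuot_sub_pos hz j).ne']
  induction k with
  | zero =>
    have h0 := hq 0
    have h1 := hq 1
    have e0 : regQuot z 0 = z := rfl
    simp only [regNum, regDen]
    push_cast
    rw [e0] at h0
    simp only [zero_add] at *
    linear_combination (-(z - (regCoeff z 0 : ℝ))) * h1 + regQuot z 2 * h0
  | succ k ih =>
    have h1 : (regNum z (k + 2) : ℝ) = regCoeff z (k + 2) * regNum z (k + 1) + regNum z k := by
      exact_mod_cast (rfl : regNum z (k + 2) = regCoeff z (k + 2) * regNum z (k + 1) + regNum z k)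
    have h2 : (regDen z (k + 2) : ℝ) = regCoeff z (k + 2) * regDen z (k + 1) + regDen z k := by
      exact_mod_cast (rfl : regDen z (k + 2) = regCoeff z (k + 2) * regDen z (k + 1) + regDen z k)
    have h3 := hq (k + 2)
    simp only [add_assoc, Nat.reduceAdd] at *
    rw [h1, h2]
    linear_combination (-(regDen z (k + 1) * z - regNum z (k + 1))) * h3 + regQuot z (k + 3) * ih

/-- Writing δ for the error q_k z - p_k and w for z_{k+2}, the determinant identity becomes δ *
(q_{k+1} + q_k / w) = (-1)^k, and q_k / w is positive. -/
theorem regDen_succ_mul_abs_le {z : ℝ} (hz : Irrational z) (k : ℕ) :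
    (regDen z (k + 1) : ℝ) * |regDen z k * z - regNum z k| ≤ 1 := by
  have h1 := regDen_mul_sub_succ hz k
  have h2 : (regNum z (k + 1) * regDen z k - regNum z k * regDen z (k + 1) : ℝ) = (-1) ^ k := by
    exact_mod_cast regNum_mul_regDen_sub z k
  have hw : 0 < regQuot z (k + 2) := one_pos.trans (one_lt_regQuot_succ hz (k + 1))
  have hq0 : (0 : ℝ) < regDen z k := by exact_mod_cast regDen_pos hz k
  have hq1 : (0 : ℝ) < regDen z (k + 1) := by exact_mod_cast regDen_pos hz (k + 1)
  have h3 : (regDen z k * z - regNum z k) * (regDen z (k + 1) + regDen z k / regQuot z (k + 2))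
      = (-1) ^ k := by
    have h4 : (regDen z (k + 1) * z - regNum z (k + 1) : ℝ)
        = -(regDen z k * z - regNum z k) / regQuot z (k + 2) := by
      rw [eq_div_iff hw.ne']; linarith
    have h5 : (regDen z k * z - regNum z k) * (regDen z (k + 1) + regDen z k / regQuot z (k + 2))
      = (regDen z k * z - regNum z k) * regDen z (k + 1)
        - regDen z k * (-(regDen z k * z - regNum z k) / regQuot z (k + 2)) := by ring
    rw [h5, ← h4, ← h2]
    ring
  have h6 := congrArg abs h3
  have hs : 0 < regDen z (k + 1) + regDen z k / regQuot z (k + 2) := by positivity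
  rw [abs_mul, abs_pow, abs_neg, abs_one, one_pow, abs_of_pos hs] at h6
  have h7 : 0 ≤ |regDen z k * z - regNum z k| * (regDen z k / regQuot z (k + 2)) := by positivity
  nlinarith

theorem abs_regNum_div_regDen_le {z : ℝ} (hz : Irrational z) (k : ℕ) :
    |(regNum z k : ℝ) / regDen z k| ≤ |z| + 1 := by
  have h := regDen_succ_mul_abs_le hz k
  have hq0 : (1 : ℝ) ≤ regDen z k := by exact_mod_cast regDen_pos hz k
  have hq1 : (1 : ℝ) ≤ regDen z (k + 1) := by exact_mod_cast regDen_pos hz (k + 1)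
  have h1 : |regDen z k * z - regNum z k| ≤ 1 := by
    nlinarith [abs_nonneg (regDen z k * z - regNum z k)]
  have h2 : (regNum z k : ℝ) / regDen z k = z - (regDen z k * z - regNum z k) / regDen z k := by
    field_simp; ring
  have h3 : |(regDen z k * z - regNum z k) / regDen z k| ≤ 1 := by
    rw [abs_div, div_le_one (by positivity), abs_of_pos (by linarith : (0 : ℝ) < regDen z k)]
    linarith
  rw [h2]
  exact (abs_sub _ _).trans (by linarith)

/-- The determinant gives p_{k+1} q_k ≡ (-1)^k modulo q_{k+1}. -/
theorem dedekindS_regNum_succ {z : ℝ} (hz : Irrational z) (k : ℕ) :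
    dedekindS (regNum z (k + 1)) (regDen z (k + 1))
      = (-1) ^ k * dedekindS (regDen z k) (regDen z (k + 1)) := by
  have hq := regDen_pos hz (k + 1)
  have h := regNum_mul_regDen_sub z k
  rcases Nat.even_or_odd k with hk | hk
  · rw [hk.neg_one_pow] at h ⊢
    rw [one_mul]
    refine dedekindS_eq_of_mul_modEq_one hq (Int.modEq_iff_dvd.2 ⟨-regNum z k, ?_⟩)
    linear_combination -h
  · rw [hk.neg_one_pow] at h ⊢
    rw [neg_one_mul, ← dedekindS_neg hq]
    refine dedekindS_eq_of_mul_modEq_one hq (Int.modEq_iff_dvd.2 ⟨regNum z k, ?_⟩)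
    linear_combination h

/-- Reciprocity for q_{k+1} and q_{k+2}, with q_{k+2} ≡ q_k modulo q_{k+1}. The term 1 / (q_{k+1}
q_{k+2}) is, up to sign, a difference of convergents, so it telescopes. -/
theorem dedekindS_regNum_add_two {z : ℝ} (hz : Irrational z) (k : ℕ) :
    dedekindS (regNum z (k + 2)) (regDen z (k + 2))
      = dedekindS (regNum z (k + 1)) (regDen z (k + 1)) + (-1) ^ (k + 1) *
        (-3 + (regDen z (k + 1) : ℝ) / regDen z (k + 2) + (regDen z k : ℝ) / regDen z (k + 1)
          + regCoeff z (k + 2)) + ((regNum z (k + 2) : ℝ) / regDen z (k + 2)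
            - (regNum z (k + 1) : ℝ) / regDen z (k + 1)) := by
  have hq1 := regDen_pos hz (k + 1)
  have hq2 := regDen_pos hz (k + 2)
  have hq1' : (regDen z (k + 1) : ℝ) ≠ 0 := by exact_mod_cast hq1.ne'
  have hq2' : (regDen z (k + 2) : ℝ) ≠ 0 := by exact_mod_cast hq2.ne'
  have h2 : regDen z (k + 2) = regCoeff z (k + 2) * regDen z (k + 1) + regDen z k := rfl
  have h2' : (regDen z (k + 2) : ℝ) = regCoeff z (k + 2) * regDen z (k + 1) + regDen z k := by
    exact_mod_cast h2
  have hrec := dedekindS_reciprocity hq1 hq2 (isCoprime_regDen z (k + 1))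
  have hmod : dedekindS (regDen z (k + 2)) (regDen z (k + 1))
      = dedekindS (regDen z k) (regDen z (k + 1)) :=
    dedekindS_congr hq1 (Int.modEq_iff_dvd.2 ⟨-regCoeff z (k + 2), by rw [h2]; ring⟩)
  have hdet : (regNum z (k + 2) * regDen z (k + 1) - regNum z (k + 1) * regDen z (k + 2) : ℝ)
      = (-1) ^ (k + 1) := by
    exact_mod_cast regNum_mul_regDen_sub z (k + 1)
  have hfrac : (regNum z (k + 2) : ℝ) / regDen z (k + 2) - (regNum z (k + 1) : ℝ) / regDen z (k + 1)
      = (-1) ^ (k + 1) * (1 / ((regDen z (k + 1) : ℝ) * regDen z (k + 2))) := by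
    rw [← hdet]; field_simp
  have hdiv : (regDen z (k + 2) : ℝ) / regDen z (k + 1)
      = regCoeff z (k + 2) + (regDen z k : ℝ) / regDen z (k + 1) := by
    rw [h2']; field_simp
  rw [hfrac, dedekindS_regNum_succ hz (k + 1), dedekindS_regNum_succ hz k]
  rw [hmod, hdiv] at hrec
  rw [pow_succ]
  linear_combination (-(-1) ^ k) * hrec

theorem exists_abs_dedekindS_regNum_sub_le {z : ℝ} (hz : Irrational z) :
    ∃ C : ℝ, ∀ k, |dedekindS (regNum z k) (regDen z k)
      - ∑ j ∈ Finset.range (k + 1), (((-1) ^ (j + 1) * regCoeff z j : ℤ) : ℝ)| ≤ C := by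
  set f : ℕ → ℝ := fun k => dedekindS (regNum z k) (regDen z k)
      - ∑ j ∈ Finset.range (k + 1), (((-1) ^ (j + 1) * regCoeff z j : ℤ) : ℝ) with hf
  -- The primitive of the non-coefficient terms of the recursion: the alternating -3 integrates to
  -- ∓3/2, and consecutive denominator ratios enter with opposite signs.
  set g : ℕ → ℝ := fun k => (-1) ^ k * ((regDen z k : ℝ) / regDen z (k + 1) - 3 / 2)
    + (regNum z (k + 1) : ℝ) / regDen z (k + 1) with hg
  have hconst : ∀ k, f (k + 1) - g k = f 1 - g 0 := by
    intro k
    induction k with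
    | zero => rfl
    | succ k ih =>
      rw [← ih, hf, hg]
      simp only [add_assoc, Nat.reduceAdd]
      rw [dedekindS_regNum_add_two hz k, Finset.sum_range_succ _ (k + 2)]
      push_cast
      ring
  have hgb : ∀ k, |g k| ≤ |z| + 4 := by
    intro k
    have h1 := abs_regNum_div_regDen_le hz (k + 1)
    have hq0 : (0 : ℝ) < regDen z k := by exact_mod_cast regDen_pos hz k
    have hq1 : (0 : ℝ) < regDen z (k + 1) := by exact_mod_cast regDen_pos hz (k + 1)
    have hle : (regDen z k : ℝ) ≤ regDen z (k + 1) := by exact_mod_cast regDen_le_succ hz k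
    have h2 : (regDen z k : ℝ) / regDen z (k + 1) ≤ 1 := by rwa [div_le_one hq1]
    have h3 : 0 ≤ (regDen z k : ℝ) / regDen z (k + 1) := by positivity
    have h4 : |(-1 : ℝ) ^ k * ((regDen z k : ℝ) / regDen z (k + 1) - 3 / 2)| ≤ 3 := by
      rw [abs_mul, abs_pow, abs_neg, abs_one, one_pow, one_mul, abs_le]
      constructor <;> linarith
    exact (abs_add_le _ _).trans (by linarith)
  refine ⟨|f 0| + (|f 1 - g 0| + (|z| + 4)), fun k => ?_⟩
  change |f k| ≤ _
  rcases k with _ | k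
  · have := abs_nonneg (f 1 - g 0)
    have := abs_nonneg z
    linarith
  · have h1 : f (k + 1) = (f 1 - g 0) + g k := by rw [← hconst k]; ring
    rw [h1]
    have := abs_add_le (f 1 - g 0) (g k)
    have := abs_nonneg (f 0)
    have := hgb k
    linarith

/-! ### The negative regular expansion -/

theorem negQuot_succ (z : ℝ) (j : ℕ) :
    negQuot z (j + 1) = 1 / ((negCoeff z j : ℝ) - negQuot z j) :=
  rfl

theorem irrational_negQuot {z : ℝ} (hz : Irrational z) (j : ℕ) : Irrational (negQuot z j) := by
  induction j with
  | zero => exact hz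
  | succ j ih =>
    rw [negQuot_succ, one_div]
    exact (ih.intCast_sub _).inv

theorem negCoeff_sub_pos {z : ℝ} (hz : Irrational z) (j : ℕ) :
    0 < (negCoeff z j : ℝ) - negQuot z j := by
  have h1 : negQuot z j ≤ (negCoeff z j : ℝ) := Int.le_ceil _
  have h2 := (irrational_negQuot hz j).ne_int (negCoeff z j)
  exact sub_pos.2 (lt_of_le_of_ne h1 h2)

theorem one_lt_negQuot_succ {z : ℝ} (hz : Irrational z) (j : ℕ) : 1 < negQuot z (j + 1) := by
  rw [negQuot_succ, one_lt_div (negCoeff_sub_pos hz j)]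
  have : (negCoeff z j : ℝ) < negQuot z j + 1 := Int.ceil_lt_add_one _
  linarith

theorem two_le_negCoeff_succ {z : ℝ} (hz : Irrational z) (j : ℕ) : 2 ≤ negCoeff z (j + 1) := by
  have h : 1 < negCoeff z (j + 1) := by
    rw [negCoeff, Int.lt_ceil]
    exact_mod_cast one_lt_negQuot_succ hz j
  omega

theorem negDen_pos_and_le {z : ℝ} (hz : Irrational z) (k : ℕ) :
    0 < negDen z k ∧ negDen z k ≤ negDen z (k + 1) := by
  induction k with
  | zero =>
    have := two_le_negCoeff_succ hz 0
    simp only [negDen]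
    constructor <;> linarith
  | succ k ih =>
    have h1 := two_le_negCoeff_succ hz (k + 1)
    have h2 : negDen z (k + 2) = negCoeff z (k + 2) * negDen z (k + 1) - negDen z k := rfl
    have h3 : 0 < negDen z (k + 1) := ih.1.trans_le ih.2
    refine ⟨h3, ?_⟩
    rw [h2]
    nlinarith [ih.2]

theorem negDen_pos {z : ℝ} (hz : Irrational z) (k : ℕ) : 0 < negDen z k :=
  (negDen_pos_and_le hz k).1

theorem negDen_le_succ {z : ℝ} (hz : Irrational z) (k : ℕ) : negDen z k ≤ negDen z (k + 1) :=
  (negDen_pos_and_le hz k).2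

theorem negNum_mul_negDen_sub (z : ℝ) (k : ℕ) :
    negNum z (k + 1) * negDen z k - negNum z k * negDen z (k + 1) = -1 := by
  induction k with
  | zero => simp only [negNum, negDen]; ring
  | succ k ih =>
    have h1 : negNum z (k + 2) = negCoeff z (k + 2) * negNum z (k + 1) - negNum z k := rfl
    have h2 : negDen z (k + 2) = negCoeff z (k + 2) * negDen z (k + 1) - negDen z k := rfl
    rw [h1, h2, ← ih]
    ring

theorem isCoprime_negDen (z : ℝ) (k : ℕ) : IsCoprime (negDen z k) (negDen z (k + 1)) :=
  ⟨-negNum z (k + 1), negNum z k, by linear_combination -negNum_mul_negDen_sub z k⟩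

theorem negNum_sub_succ {z : ℝ} (hz : Irrational z) (k : ℕ) :
    (negNum z k - negDen z k * z : ℝ)
      = negQuot z (k + 2) * (negNum z (k + 1) - negDen z (k + 1) * z) := by
  have hq (j : ℕ) : negQuot z (j + 1) * (negCoeff z j - negQuot z j) = 1 := by
    rw [negQuot_succ, one_div, inv_mul_cancel₀ (negCoeff_sub_pos hz j).ne']
  induction k with
  | zero =>
    have h0 := hq 0
    have h1 := hq 1
    have e0 : negQuot z 0 = z := rfl
    simp only [negNum, negDen]
    push_cast
    rw [e0] at h0
    simp only [zero_add] at *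
    linear_combination (-((negCoeff z 0 : ℝ) - z)) * h1 - negQuot z 2 * h0
  | succ k ih =>
    have h1 : (negNum z (k + 2) : ℝ) = negCoeff z (k + 2) * negNum z (k + 1) - negNum z k := by
      exact_mod_cast (rfl : negNum z (k + 2) = negCoeff z (k + 2) * negNum z (k + 1) - negNum z k)
    have h2 : (negDen z (k + 2) : ℝ) = negCoeff z (k + 2) * negDen z (k + 1) - negDen z k := by
      exact_mod_cast (rfl : negDen z (k + 2) = negCoeff z (k + 2) * negDen z (k + 1) - negDen z k)
    have h3 := hq (k + 2)
    simp only [add_assoc, Nat.reduceAdd] at *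
    rw [h1, h2]
    linear_combination (-(negNum z (k + 1) - negDen z (k + 1) * z)) * h3 + negQuot z (k + 3) * ih

/-- The errors start in (0, 1) and are divided by a complete quotient greater than 1 at every step.
-/
theorem negNum_sub_mem {z : ℝ} (hz : Irrational z) (k : ℕ) :
    0 < (negNum z k - negDen z k * z : ℝ) ∧ (negNum z k - negDen z k * z : ℝ) ≤ 1 := by
  induction k with
  | zero =>
    have h1 := negCoeff_sub_pos hz 0
    have h2 : (negCoeff z 0 : ℝ) < negQuot z 0 + 1 := Int.ceil_lt_add_one _
    have e0 : negQuot z 0 = z := rfl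
    rw [e0] at h1 h2
    simp only [negNum, negDen]
    push_cast
    constructor <;> linarith
  | succ k ih =>
    have h := negNum_sub_succ hz k
    have hw := one_lt_negQuot_succ hz (k + 1)
    rw [h] at ih
    have hpos := pos_of_mul_pos_right ih.1 (by linarith : 0 ≤ negQuot z (k + 2))
    refine ⟨hpos, ?_⟩
    nlinarith [ih.2]

theorem abs_negNum_div_negDen_le {z : ℝ} (hz : Irrational z) (k : ℕ) :
    |(negNum z k : ℝ) / negDen z k| ≤ |z| + 1 := by
  obtain ⟨h0, h1⟩ := negNum_sub_mem hz k
  have hq0 : (1 : ℝ) ≤ negDen z k := by exact_mod_cast negDen_pos hz k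
  have h2 : (negNum z k : ℝ) / negDen z k = z + (negNum z k - negDen z k * z) / negDen z k := by
    field_simp; ring
  have h3 : |(negNum z k - negDen z k * z) / negDen z k| ≤ 1 := by
    rw [abs_div, div_le_one (by positivity), abs_of_pos (by linarith : (0 : ℝ) < negDen z k),
      abs_of_pos h0]
    linarith
  rw [h2]
  exact (abs_add_le _ _).trans (by linarith)

theorem dedekindS_negNum_succ {z : ℝ} (hz : Irrational z) (k : ℕ) :
    dedekindS (negNum z (k + 1)) (negDen z (k + 1))
      = -dedekindS (negDen z k) (negDen z (k + 1)) := by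
  have hq := negDen_pos hz (k + 1)
  have h := negNum_mul_negDen_sub z k
  rw [← dedekindS_neg hq]
  refine dedekindS_eq_of_mul_modEq_one hq (Int.modEq_iff_dvd.2 ⟨negNum z k, ?_⟩)
  linear_combination h

/-- Here the determinant is always -1 and t_{k+2} ≡ -t_k modulo t_{k+1}. Without alternating signs
the constant 3 of the reciprocity law accumulates, and the ratios t_k / t_{k+1} telescope. -/
theorem dedekindS_negNum_add_two {z : ℝ} (hz : Irrational z) (k : ℕ) :
    dedekindS (negNum z (k + 2)) (negDen z (k + 2))
      = dedekindS (negNum z (k + 1)) (negDen z (k + 1)) + (3 - negCoeff z (k + 2))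
        - (negDen z (k + 1) : ℝ) / negDen z (k + 2) + (negDen z k : ℝ) / negDen z (k + 1)
        + ((negNum z (k + 2) : ℝ) / negDen z (k + 2)
            - (negNum z (k + 1) : ℝ) / negDen z (k + 1)) := by
  have hq1 := negDen_pos hz (k + 1)
  have hq2 := negDen_pos hz (k + 2)
  have hq1' : (negDen z (k + 1) : ℝ) ≠ 0 := by exact_mod_cast hq1.ne'
  have hq2' : (negDen z (k + 2) : ℝ) ≠ 0 := by exact_mod_cast hq2.ne'
  have h2 : negDen z (k + 2) = negCoeff z (k + 2) * negDen z (k + 1) - negDen z k := rfl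
  have h2' : (negDen z (k + 2) : ℝ) = negCoeff z (k + 2) * negDen z (k + 1) - negDen z k := by
    exact_mod_cast h2
  have hrec := dedekindS_reciprocity hq1 hq2 (isCoprime_negDen z (k + 1))
  have hmod : dedekindS (negDen z (k + 2)) (negDen z (k + 1))
      = -dedekindS (negDen z k) (negDen z (k + 1)) := by
    rw [← dedekindS_neg hq1]
    exact dedekindS_congr hq1 (Int.modEq_iff_dvd.2 ⟨-negCoeff z (k + 2), by rw [h2]; ring⟩)
  have hdet : (negNum z (k + 2) * negDen z (k + 1) - negNum z (k + 1) * negDen z (k + 2) : ℝ)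
      = -1 := by
    exact_mod_cast negNum_mul_negDen_sub z (k + 1)
  have hfrac : (negNum z (k + 2) : ℝ) / negDen z (k + 2) - (negNum z (k + 1) : ℝ) / negDen z (k + 1)
      = -1 * (1 / ((negDen z (k + 1) : ℝ) * negDen z (k + 2))) := by
    rw [← hdet]; field_simp
  have hdiv : (negDen z (k + 2) : ℝ) / negDen z (k + 1)
      = negCoeff z (k + 2) - (negDen z k : ℝ) / negDen z (k + 1) := by
    rw [h2']; field_simp
  rw [hfrac, dedekindS_negNum_succ hz (k + 1), dedekindS_negNum_succ hz k]
  rw [hmod, hdiv] at hrec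
  linear_combination -hrec

theorem exists_abs_dedekindS_negNum_sub_le {z : ℝ} (hz : Irrational z) :
    ∃ C : ℝ, ∀ k, |dedekindS (negNum z k) (negDen z k)
      - ∑ j ∈ Finset.range (k + 1), ((3 - negCoeff z j : ℤ) : ℝ)| ≤ C := by
  set f : ℕ → ℝ := fun k => dedekindS (negNum z k) (negDen z k)
      - ∑ j ∈ Finset.range (k + 1), ((3 - negCoeff z j : ℤ) : ℝ) with hf
  set g : ℕ → ℝ := fun k => -((negDen z k : ℝ) / negDen z (k + 1))
    + (negNum z (k + 1) : ℝ) / negDen z (k + 1) with hg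
  have hconst : ∀ k, f (k + 1) - g k = f 1 - g 0 := by
    intro k
    induction k with
    | zero => rfl
    | succ k ih =>
      rw [← ih, hf, hg]
      simp only [add_assoc, Nat.reduceAdd]
      rw [dedekindS_negNum_add_two hz k, Finset.sum_range_succ _ (k + 2)]
      push_cast
      ring
  have hgb : ∀ k, |g k| ≤ |z| + 2 := by
    intro k
    have h1 := abs_negNum_div_negDen_le hz (k + 1)
    have hq0 : (0 : ℝ) < negDen z k := by exact_mod_cast negDen_pos hz k
    have hq1 : (0 : ℝ) < negDen z (k + 1) := by exact_mod_cast negDen_pos hz (k + 1)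
    have hle : (negDen z k : ℝ) ≤ negDen z (k + 1) := by exact_mod_cast negDen_le_succ hz k
    have h2 : (negDen z k : ℝ) / negDen z (k + 1) ≤ 1 := by rwa [div_le_one hq1]
    have h3 : 0 ≤ (negDen z k : ℝ) / negDen z (k + 1) := by positivity
    have h4 : |-((negDen z k : ℝ) / negDen z (k + 1))| ≤ 1 := by
      rw [abs_neg, abs_of_nonneg h3]; exact h2
    exact (abs_add_le _ _).trans (by linarith)
  refine ⟨|f 0| + (|f 1 - g 0| + (|z| + 2)), fun k => ?_⟩
  change |f k| ≤ _
  rcases k with _ | k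
  · have := abs_nonneg (f 1 - g 0)
    have := abs_nonneg z
    linarith
  · have h1 : f (k + 1) = (f 1 - g 0) + g k := by rw [← hconst k]; ring
    rw [h1]
    have := abs_add_le (f 1 - g 0) (g k)
    have := abs_nonneg (f 0)
    have := hgb k
    linarith

/-! ### Eventual periodicity of the regular expansion -/

theorem finite_setOf_quadratic_root (M : ℤ) :
    {x : ℝ | ∃ A B C : ℤ, |A| ≤ M ∧ |B| ≤ M ∧ |C| ≤ M ∧ ¬(A = 0 ∧ B = 0 ∧ C = 0) ∧
      (A : ℝ) * x ^ 2 + B * x + C = 0}.Finite := by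
  have hroots (A B C : ℝ) (h : ¬(A = 0 ∧ B = 0 ∧ C = 0)) :
      {x : ℝ | A * x ^ 2 + B * x + C = 0}.Finite := by
    set p : Polynomial ℝ := Polynomial.C A * Polynomial.X ^ 2
      + Polynomial.C B * Polynomial.X + Polynomial.C C with hp
    have hp0 : p ≠ 0 := by
      intro h0
      have h2 : p.coeff 2 = A := by simp [hp]
      have h1 : p.coeff 1 = B := by simp [hp]
      have h00 : p.coeff 0 = C := by simp [hp]
      rw [h0, Polynomial.coeff_zero] at h2 h1 h00
      exact h ⟨h2.symm, h1.symm, h00.symm⟩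
    refine p.roots.toFinset.finite_toSet.subset fun x hx => ?_
    rw [Set.mem_ofPred_eq] at hx
    rw [Finset.mem_coe, Multiset.mem_toFinset, Polynomial.mem_roots hp0, Polynomial.IsRoot.def]
    simpa [hp] using hx
  set T : Set (ℤ × ℤ × ℤ) := {t | ¬(t.1 = 0 ∧ t.2.1 = 0 ∧ t.2.2 = 0)}
  have hfin : (T ∩ (Set.Icc (-M) M ×ˢ Set.Icc (-M) M ×ˢ Set.Icc (-M) M)).Finite :=
    (((Set.finite_Icc _ _).prod ((Set.finite_Icc _ _).prod (Set.finite_Icc _ _)))).inter_of_right _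
  refine (hfin.biUnion fun t ht => hroots t.1 t.2.1 t.2.2 (by exact_mod_cast ht.1)).subset ?_
  rintro x ⟨A, B, C, hA, hB, hC, h0, hx⟩
  simp only [Set.mem_iUnion]
  exact ⟨(A, B, C), ⟨h0, abs_le.1 hA, abs_le.1 hB, abs_le.1 hC⟩, hx⟩

/-- Lagrange's argument: the complete quotients are roots of integer quadratics with bounded
coefficients, hence take only finitely many values. -/
theorem exists_regQuot_eq {z : ℝ} (hz : IsQuadraticIrrational z) :
    ∃ i j, i < j ∧ regQuot z i = regQuot z j := by
  obtain ⟨hirr, a, b, c, ha, hroot⟩ := hz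
  set α : ℝ := 2 * a * z + b with hα
  have hα0 : α ≠ 0 := by
    intro h
    refine (hirr.intCast_mul (m := 2 * a) (by omega)).ne_int (-b) ?_
    push_cast
    linarith
  -- All three coefficients will have the form -α * s + a * t with |s|, |t| ≤ 2.
  obtain ⟨M, hM⟩ := exists_int_gt (2 * (|α| + |(a : ℝ)|))
  have hmem : ∀ k, regQuot z (k + 2) ∈ {x : ℝ | ∃ A B C : ℤ, |A| ≤ M ∧ |B| ≤ M ∧ |C| ≤ M ∧
      ¬(A = 0 ∧ B = 0 ∧ C = 0) ∧ (A : ℝ) * x ^ 2 + B * x + C = 0} := by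
    intro k
    have hw := regDen_mul_sub_succ hirr k
    have hb0 := regDen_succ_mul_abs_le hirr k
    have hb1 := regDen_succ_mul_abs_le hirr (k + 1)
    have hdet := regNum_mul_regDen_sub z k
    have hq0 : (1 : ℝ) ≤ regDen z k := by exact_mod_cast regDen_pos hirr k
    have hq01 : (regDen z k : ℝ) ≤ regDen z (k + 1) := by exact_mod_cast regDen_le_succ hirr k
    have hq12 : (regDen z (k + 1) : ℝ) ≤ regDen z (k + 1 + 1) := by
      exact_mod_cast regDen_le_succ hirr (k + 1)
    generalize regQuot z (k + 2) = w at *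
    generalize regDen z (k + 1 + 1) = q2 at *
    generalize regNum z k = p at *
    generalize regNum z (k + 1) = p' at *
    generalize regDen z k = q at *
    generalize regDen z (k + 1) = q' at *
    obtain ⟨δ, hδ⟩ : ∃ δ : ℝ, δ = q * z - p := ⟨_, rfl⟩
    obtain ⟨δ', hδ'⟩ : ∃ δ : ℝ, δ = q' * z - p' := ⟨_, rfl⟩
    rw [← hδ, ← hδ'] at hw
    rw [← hδ] at hb0
    rw [← hδ'] at hb1
    have hd0 := abs_nonneg δ
    have hd1 := abs_nonneg δ'
    have hδ1 : |δ| ≤ 1 := by nlinarith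
    have hδ'1 : |δ'| ≤ 1 := by nlinarith
    have b1 : |q * δ| ≤ 1 := by rw [abs_mul, abs_of_pos (by linarith : (0 : ℝ) < q)]; nlinarith
    have b2 : |q' * δ| ≤ 1 := by rw [abs_mul, abs_of_pos (by linarith : (0 : ℝ) < q')]; nlinarith
    have b3 : |q * δ'| ≤ 1 := by rw [abs_mul, abs_of_pos (by linarith : (0 : ℝ) < q)]; nlinarith
    have b4 : |q' * δ'| ≤ 1 := by rw [abs_mul, abs_of_pos (by linarith : (0 : ℝ) < q')]; nlinarith
    have hbound {s t : ℝ} (hs : |s| ≤ 2) (ht : |t| ≤ 2) : |-α * s + a * t| ≤ M := by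
      refine (abs_add_le _ _).trans ?_
      rw [abs_mul, abs_mul, abs_neg]
      have := mul_le_mul_of_nonneg_left hs (abs_nonneg α)
      have := mul_le_mul_of_nonneg_left ht (abs_nonneg (a : ℝ))
      linarith
    have hprod {s t : ℝ} (hs : |s| ≤ 1) (ht : |t| ≤ 1) : |s * t| ≤ 1 := by
      rw [abs_mul]; exact mul_le_one₀ hs (abs_nonneg t) ht
    have hp : (p : ℝ) = q * z - δ := by linarith
    have hp' : (p' : ℝ) = q' * z - δ' := by linarith
    -- The coefficients in w of the form a X² + b X Y + c Y² at X = p + w p', Y = q + w q', where z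
    -- = X / Y.
    refine ⟨a * p' ^ 2 + b * p' * q' + c * q' ^ 2,
      2 * a * p * p' + b * (p * q' + p' * q) + 2 * c * q * q',
      a * p ^ 2 + b * p * q + c * q ^ 2, ?_, ?_, ?_, ?_, ?_⟩
    · have e : ((a * p' ^ 2 + b * p' * q' + c * q' ^ 2 : ℤ) : ℝ)
          = -α * (q' * δ') + a * (δ' * δ') := by
        push_cast; rw [hp', hα]; linear_combination (q' : ℝ) ^ 2 * hroot
      have := hbound (b4.trans one_le_two) ((hprod hδ'1 hδ'1).trans one_le_two)
      rw [← e] at this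
      exact_mod_cast this
    · have e : ((2 * a * p * p' + b * (p * q' + p' * q) + 2 * c * q * q' : ℤ) : ℝ)
          = -α * (q' * δ + q * δ') + a * (2 * (δ * δ')) := by
        push_cast; rw [hp', hp, hα]; linear_combination (2 * q * q' : ℝ) * hroot
      have h2 : |2 * (δ * δ')| ≤ 2 := by
        rw [abs_mul, abs_two]; linarith [hprod hδ1 hδ'1]
      have := hbound ((abs_add_le (q' * δ) (q * δ')).trans (by linarith)) h2
      rw [← e] at this
      exact_mod_cast this
    · have e : ((a * p ^ 2 + b * p * q + c * q ^ 2 : ℤ) : ℝ)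
          = -α * (q * δ) + a * (δ * δ) := by
        push_cast; rw [hp, hα]; linear_combination (q : ℝ) ^ 2 * hroot
      have := hbound (b1.trans one_le_two) ((hprod hδ1 hδ1).trans one_le_two)
      rw [← e] at this
      exact_mod_cast this
    · rintro ⟨hA, hB, hC⟩
      -- The substitution has determinant ±1 and preserves the discriminant, which equals α² and is
      -- nonzero.
      have hdisc : b ^ 2 - 4 * a * c = 0 := by
        have h1 : (p' * q - p * q') ^ 2 = 1 := by rw [hdet, ← pow_mul, mul_comm, pow_mul]; simp
        linear_combination (-(b ^ 2 - 4 * a * c)) * h1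
          + (2 * a * p * p' + b * (p * q' + p' * q) + 2 * c * q * q') * hB
          - 4 * (a * p ^ 2 + b * p * q + c * q ^ 2) * hA
      have hdisc' : (b : ℝ) ^ 2 - 4 * a * c = 0 := by exact_mod_cast hdisc
      refine hα0 (pow_eq_zero_iff two_ne_zero |>.1 ?_)
      rw [hα]
      linear_combination (4 * a : ℝ) * hroot + hdisc'
    · have hPQ : (p + w * p' : ℝ) = z * (q + w * q') := by rw [hp, hp']; linarith
      push_cast
      linear_combination (q + w * q' : ℝ) ^ 2 * hroot
        + (a * ((p + w * p') + z * (q + w * q')) + b * (q + w * q') : ℝ) * hPQ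
  obtain ⟨i, j, hij, h⟩ := Set.Finite.exists_lt_map_eq_of_forall_mem hmem
    (finite_setOf_quadratic_root M)
  exact ⟨i + 2, j + 2, by omega, h⟩

theorem regQuot_add_eq {z : ℝ} {i j : ℕ} (h : regQuot z i = regQuot z j) (n : ℕ) :
    regQuot z (i + n) = regQuot z (j + n) := by
  induction n with
  | zero => exact h
  | succ n ih => rw [← add_assoc, ← add_assoc, regQuot_succ, regQuot_succ, regCoeff, regCoeff, ih]

theorem negQuot_add_eq {z : ℝ} {i j : ℕ} (h : negQuot z i = negQuot z j) (n : ℕ) :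
    negQuot z (i + n) = negQuot z (j + n) := by
  induction n with
  | zero => exact h
  | succ n ih => rw [← add_assoc, ← add_assoc, negQuot_succ, negQuot_succ, negCoeff, negCoeff, ih]

theorem eventuallyPeriodic_regCoeff {z : ℝ} (hz : IsQuadraticIrrational z) :
    EventuallyPeriodic (regCoeff z) := by
  obtain ⟨i, j, hij, h⟩ := exists_regQuot_eq hz
  refine ⟨i, j - i, by omega, fun n hn => ?_⟩
  have := regQuot_add_eq h (n - i)
  rw [show i + (n - i) = n by omega, show j + (n - i) = n + (j - i) by omega] at this
  rw [regCoeff, regCoeff, this]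

/-! ### From the regular to the negative regular expansion -/

/-- The index of the complete quotient of the negative regular expansion that corresponds to the
complete quotient of the regular expansion with index `2 * n`. -/
noncomputable def negIndex (z : ℝ) (n : ℕ) : ℕ :=
  ∑ i ∈ Finset.range n, (regCoeff z (2 * i + 1)).toNat

theorem negIndex_succ (z : ℝ) (n : ℕ) :
    negIndex z (n + 1) = negIndex z n + (regCoeff z (2 * n + 1)).toNat :=
  Finset.sum_range_succ _ _

theorem strictMono_negIndex {z : ℝ} (hz : Irrational z) : StrictMono (negIndex z) := by
  refine strictMono_nat_of_lt_succ fun n => ?_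
  have := one_le_regCoeff_succ hz (2 * n)
  rw [negIndex_succ]
  omega

theorem negCoeff_eq_of_negQuot_eq {z : ℝ} (hz : Irrational z) {j n : ℕ} {e : ℤ}
    (h : negQuot z j = regQuot z (2 * n) + e) :
    negCoeff z j = regCoeff z (2 * n) + 1 + e := by
  have h0 := regQuot_sub_pos hz (2 * n)
  have h1 : regQuot z (2 * n) < regCoeff z (2 * n) + 1 := Int.lt_floor_add_one _
  rw [negCoeff, Int.ceil_eq_iff, h]
  push_cast
  constructor <;> linarith

/-- With u = z_{2n+1} of the regular expansion, the first step gives u / (u - 1) = 1 + 1 / (u - 1).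
For v > 1 the number 1 + 1 / v has ceiling 2 and successor 1 + 1 / (v - 1), so each further step
lowers u by 1. The shift e will be 0 for the first block and 1 for all later ones. -/
theorem negQuot_block {z : ℝ} (hz : Irrational z) {j n : ℕ} {e : ℤ}
    (h : negQuot z j = regQuot z (2 * n) + e)
    (i : ℕ) (hi : (i : ℤ) + 1 ≤ regCoeff z (2 * n + 1)) :
    negQuot z (j + (i + 1)) = 1 + 1 / (regQuot z (2 * n + 1) - ((i : ℝ) + 1)) := by
  have hy := regQuot_sub_pos hz (2 * n + 1)
  have hi' : ((i : ℝ) + 1) ≤ regCoeff z (2 * n + 1) := by exact_mod_cast hi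
  induction i with
  | zero =>
    have h1 : regQuot z (2 * n) - regCoeff z (2 * n) = 1 / regQuot z (2 * n + 1) := by
      rw [regQuot_succ, one_div_one_div]
    have hw := one_lt_regQuot_succ hz (2 * n)
    rw [zero_add, negQuot_succ, negCoeff_eq_of_negQuot_eq hz h, h]
    push_cast
    have h2 : (regCoeff z (2 * n) : ℝ) + 1 + e - (regQuot z (2 * n) + e)
        = 1 - 1 / regQuot z (2 * n + 1) := by rw [← h1]; ring
    have h3 : regQuot z (2 * n + 1) - 1 ≠ 0 := by linarith
    have h4 : regQuot z (2 * n + 1) ≠ 0 := by linarith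
    rw [h2]
    simp only [zero_add]
    field_simp
    ring
  | succ i ih =>
    push_cast at hi hi' ⊢
    have h1 := ih (by omega) (by linarith)
    have h2 : 1 < regQuot z (2 * n + 1) - ((i : ℝ) + 1) := by linarith
    have h3 : negCoeff z (j + (i + 1)) = 2 := by
      rw [negCoeff, Int.ceil_eq_iff, h1]
      have h4 : 0 < 1 / (regQuot z (2 * n + 1) - ((i : ℝ) + 1)) := by positivity
      have h5 : 1 / (regQuot z (2 * n + 1) - ((i : ℝ) + 1)) < 1 := by
        rw [div_lt_one (by linarith)]; exact h2
      push_cast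
      constructor <;> linarith
    rw [← add_assoc j (i + 1) 1, negQuot_succ, h3, h1]
    push_cast
    have h6 : regQuot z (2 * n + 1) - ((i : ℝ) + 1 + 1)
        = (regQuot z (2 * n + 1) - ((i : ℝ) + 1)) - 1 := by ring
    rw [h6]
    generalize regQuot z (2 * n + 1) - ((i : ℝ) + 1) = u at *
    have h7 : u ≠ 0 := by linarith
    have h8 : u - 1 ≠ 0 := by linarith
    have h9 : (2 : ℝ) - (1 + 1 / u) = (u - 1) / u := by field_simp; ring
    rw [h9]
    field_simp
    ring

theorem negCoeff_block {z : ℝ} (hz : Irrational z) {j n : ℕ} {e : ℤ}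
    (h : negQuot z j = regQuot z (2 * n) + e) (i : ℕ)
    (hi : (i : ℤ) + 1 < regCoeff z (2 * n + 1)) : negCoeff z (j + (i + 1)) = 2 := by
  have hy := regQuot_sub_pos hz (2 * n + 1)
  have hi' : ((i : ℝ) + 1) + 1 ≤ regCoeff z (2 * n + 1) := by exact_mod_cast hi
  have h2 : 1 < regQuot z (2 * n + 1) - ((i : ℝ) + 1) := by linarith
  have h4 : 0 < 1 / (regQuot z (2 * n + 1) - ((i : ℝ) + 1)) := by positivity
  have h5 : 1 / (regQuot z (2 * n + 1) - ((i : ℝ) + 1)) < 1 := by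
    rw [div_lt_one (by linarith)]; exact h2
  rw [negCoeff, Int.ceil_eq_iff, negQuot_block hz h i hi.le]
  push_cast
  constructor <;> linarith

theorem negQuot_block_end {z : ℝ} (hz : Irrational z) {j n : ℕ} {e : ℤ}
    (h : negQuot z j = regQuot z (2 * n) + e) :
    negQuot z (j + (regCoeff z (2 * n + 1)).toNat) = regQuot z (2 * (n + 1)) + (1 : ℤ) := by
  obtain ⟨i, hi⟩ := Int.eq_ofNat_of_zero_le (sub_nonneg.2 (one_le_regCoeff_succ hz (2 * n)))
  have hi' : regCoeff z (2 * n + 1) = (i : ℤ) + 1 := by omega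
  have h1 := negQuot_block hz h i hi'.ge
  have h2 : (regCoeff z (2 * n + 1)).toNat = i + 1 := by omega
  rw [h2, h1, show 2 * (n + 1) = 2 * n + 1 + 1 by ring, regQuot_succ z (2 * n + 1), hi']
  push_cast
  ring

/-- The leading coefficient contributes 2 - a_{2n} - e; each of the a_{2n+1} - 1 twos contributes 1.
-/
theorem sum_negCoeff_block {z : ℝ} (hz : Irrational z) {j n : ℕ} {e : ℤ}
    (h : negQuot z j = regQuot z (2 * n) + e) :
    ∑ i ∈ Finset.range (regCoeff z (2 * n + 1)).toNat, (3 - negCoeff z (j + i))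
      = regCoeff z (2 * n + 1) - regCoeff z (2 * n) + 1 - e := by
  obtain ⟨i, hi⟩ := Int.eq_ofNat_of_zero_le (sub_nonneg.2 (one_le_regCoeff_succ hz (2 * n)))
  have hi' : regCoeff z (2 * n + 1) = (i : ℤ) + 1 := by omega
  have h2 : (regCoeff z (2 * n + 1)).toNat = i + 1 := by omega
  have h3 : ∀ k ∈ Finset.range i, 3 - negCoeff z (j + (k + 1)) = 1 := by
    intro k hk
    rw [Finset.mem_range] at hk
    rw [negCoeff_block hz h k (by omega)]
    norm_num
  rw [h2, Finset.sum_range_succ', Finset.sum_congr rfl h3, add_zero,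
    negCoeff_eq_of_negQuot_eq hz h, hi']
  simp
  ring

theorem negQuot_negIndex_succ {z : ℝ} (hz : Irrational z) (n : ℕ) :
    negQuot z (negIndex z (n + 1)) = regQuot z (2 * (n + 1)) + (1 : ℤ) := by
  induction n with
  | zero =>
    rw [negIndex_succ]
    exact negQuot_block_end hz (e := 0) (by simp [negIndex, negQuot, regQuot])
  | succ n ih =>
    rw [negIndex_succ]
    exact negQuot_block_end hz ih

/-- The extra 1 comes from the first block, the only one with e = 0. -/
theorem sum_range_negIndex_succ {z : ℝ} (hz : Irrational z) (n : ℕ) :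
    ∑ i ∈ Finset.range (negIndex z (n + 1)), (3 - negCoeff z i)
      = ∑ j ∈ Finset.range (2 * (n + 1)), (-1) ^ (j + 1) * regCoeff z j + 1 := by
  have hpow (m : ℕ) : (-1 : ℤ) ^ (2 * m + 1) = -1 := (odd_two_mul_add_one m).neg_one_pow
  have hpow' (m : ℕ) : (-1 : ℤ) ^ (2 * m + 1 + 1) = 1 := by rw [pow_succ, hpow]; norm_num
  induction n with
  | zero =>
    have h := sum_negCoeff_block hz (j := 0) (n := 0) (e := 0) (by simp [negQuot, regQuot])
    have h1 : negIndex z (0 + 1) = (regCoeff z (2 * 0 + 1)).toNat := by simp [negIndex]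
    simp only [zero_add] at h h1 ⊢
    rw [h1, h]
    simp [Finset.sum_range_succ]
    ring
  | succ n ih =>
    have h := sum_negCoeff_block hz (negQuot_negIndex_succ hz n)
    rw [negIndex_succ, Finset.sum_range_add, ih, h, show 2 * (n + 1 + 1) = 2 * (n + 1) + 1 + 1 by ring,
      Finset.sum_range_succ, Finset.sum_range_succ, hpow, hpow']
    ring

theorem eventuallyPeriodic_negCoeff {z : ℝ} (hz : IsQuadraticIrrational z) :
    EventuallyPeriodic (negCoeff z) := by
  obtain ⟨i, j, hij, h⟩ := exists_regQuot_eq hz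
  obtain ⟨p, rfl⟩ := Nat.exists_eq_add_of_lt hij
  -- Going through the period p + 1 twice connects two even indices; both are positive, so the shift
  -- is 1 at each.
  have h1 : regQuot z (2 * (i + 1)) = regQuot z (2 * (i + p + 1 + 1)) := by
    have e1 := regQuot_add_eq h (i + 2)
    have e2 := regQuot_add_eq h (i + 2 + (p + 1))
    rw [show i + p + 1 + (i + 2) = i + (i + 2 + (p + 1)) by ring, e2] at e1
    convert e1 using 2 <;> ring
  have h2 : negQuot z (negIndex z (i + 1)) = negQuot z (negIndex z (i + p + 1 + 1)) := by
    rw [negQuot_negIndex_succ hz.1, negQuot_negIndex_succ hz.1, h1]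
  have hlt : negIndex z (i + 1) < negIndex z (i + p + 1 + 1) :=
    strictMono_negIndex hz.1 (by omega)
  refine ⟨negIndex z (i + 1), negIndex z (i + p + 1 + 1) - negIndex z (i + 1), by omega,
    fun n hn => ?_⟩
  have := negQuot_add_eq h2 (n - negIndex z (i + 1))
  rw [show negIndex z (i + 1) + (n - negIndex z (i + 1)) = n by omega,
    show negIndex z (i + p + 1 + 1) + (n - negIndex z (i + 1))
      = n + (negIndex z (i + p + 1 + 1) - negIndex z (i + 1)) by omega] at this
  rw [negCoeff, negCoeff, this]

/-! ### Linear growth -/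

/-- The sequence `f` differs from `n ↦ s * n` by a bounded sequence. -/
def HasLinearGrowth (f : ℕ → ℝ) (s : ℝ) : Prop := ∃ C : ℝ, ∀ n : ℕ, |f n - s * n| ≤ C

namespace HasLinearGrowth

variable {f g : ℕ → ℝ} {s t : ℝ}

theorem comp_succ (hf : HasLinearGrowth f s) : HasLinearGrowth (fun n => f (n + 1)) s := by
  obtain ⟨C, hC⟩ := hf
  refine ⟨C + |s|, fun n => ?_⟩
  have h := hC (n + 1)
  have e : f (n + 1) - s * n = (f (n + 1) - s * ((n + 1 : ℕ) : ℝ)) + s := by push_cast; ring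
  rw [e]
  exact (abs_add_le _ _).trans (by linarith)

theorem of_abs_sub_le (hf : HasLinearGrowth f s) (h : ∃ C : ℝ, ∀ n, |g n - f n| ≤ C) :
    HasLinearGrowth g s := by
  obtain ⟨C, hC⟩ := hf
  obtain ⟨C', hC'⟩ := h
  refine ⟨C' + C, fun n => ?_⟩
  have e : g n - s * n = (g n - f n) + (f n - s * n) := by ring
  rw [e]
  exact (abs_add_le _ _).trans (add_le_add (hC' n) (hC n))

theorem neg (hf : HasLinearGrowth f s) : HasLinearGrowth (fun n => -f n) (-s) := by
  obtain ⟨C, hC⟩ := hf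
  refine ⟨C, fun n => ?_⟩
  have e : -f n - -s * n = -(f n - s * n) := by ring
  rw [e, abs_neg]
  exact hC n

theorem tendsto_atTop (hf : HasLinearGrowth f s) (hs : 0 < s) :
    Filter.Tendsto f Filter.atTop Filter.atTop := by
  obtain ⟨C, hC⟩ := hf
  refine Filter.tendsto_atTop_mono (f := fun n : ℕ => s * n + -C)
    (fun n => by linarith [(abs_le.1 (hC n)).1]) ?_
  exact Filter.tendsto_atTop_add_const_right _ _
    (tendsto_natCast_atTop_atTop.const_mul_atTop hs)

theorem tendsto_atBot (hf : HasLinearGrowth f s) (hs : s < 0) :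
    Filter.Tendsto f Filter.atTop Filter.atBot := by
  have := hf.neg.tendsto_atTop (neg_pos.2 hs)
  simpa [Function.comp_def] using Filter.tendsto_neg_atTop_atBot.comp this

theorem bounded (hf : HasLinearGrowth f 0) : ∃ C : ℝ, ∀ n, |f n| ≤ C := by
  obtain ⟨C, hC⟩ := hf
  exact ⟨C, fun n => by simpa using hC n⟩

/-- If t ≤ 0, then g is bounded above, whereas f ∘ φ tends to infinity. -/
theorem slope_pos_of_comp (hf : HasLinearGrowth f s) (hg : HasLinearGrowth g t) {φ ψ : ℕ → ℕ}
    (hφ : Filter.Tendsto φ Filter.atTop Filter.atTop) {C : ℝ}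
    (h : ∀ n, |f (φ n) - g (ψ n)| ≤ C) (hs : 0 < s) : 0 < t := by
  by_contra! ht
  obtain ⟨C', hC'⟩ := hg
  obtain ⟨n, hn⟩ := (((hf.tendsto_atTop hs).comp hφ).eventually_gt_atTop (C + C')).exists
  have h1 := (abs_le.1 (h n)).2
  have h2 := (abs_le.1 (hC' (ψ n))).2
  have h3 : t * (ψ n : ℝ) ≤ 0 := mul_nonpos_of_nonpos_of_nonneg ht (Nat.cast_nonneg _)
  rw [Function.comp_apply] at hn
  linarith

theorem slope_pos_iff_of_comp (hf : HasLinearGrowth f s) (hg : HasLinearGrowth g t) {φ ψ : ℕ → ℕ}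
    (hφ : Filter.Tendsto φ Filter.atTop Filter.atTop)
    (hψ : Filter.Tendsto ψ Filter.atTop Filter.atTop) {C : ℝ}
    (h : ∀ n, |f (φ n) - g (ψ n)| ≤ C) : 0 < s ↔ 0 < t :=
  ⟨slope_pos_of_comp hf hg hφ h, slope_pos_of_comp hg hf hψ fun n => by
    rw [abs_sub_comm]; exact h n⟩

theorem slope_neg_iff_of_comp (hf : HasLinearGrowth f s) (hg : HasLinearGrowth g t) {φ ψ : ℕ → ℕ}
    (hφ : Filter.Tendsto φ Filter.atTop Filter.atTop)
    (hψ : Filter.Tendsto ψ Filter.atTop Filter.atTop) {C : ℝ}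
    (h : ∀ n, |f (φ n) - g (ψ n)| ≤ C) : s < 0 ↔ t < 0 := by
  rw [← neg_pos, ← neg_pos (a := t)]
  refine slope_pos_iff_of_comp hf.neg hg.neg hφ hψ (C := C) fun n => ?_
  rw [neg_sub_neg, abs_sub_comm]
  exact h n

end HasLinearGrowth

/-! ### Partial sums of eventually periodic sequences -/

theorem exists_abs_le_of_eventually_periodic {g : ℕ → ℝ} {N l : ℕ} (hl : 0 < l)
    (hg : ∀ n, N ≤ n → g (n + l) = g n) : ∃ C : ℝ, ∀ n, |g n| ≤ C := by
  refine ⟨∑ i ∈ Finset.range (N + l), |g i|, fun n => ?_⟩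
  induction n using Nat.strong_induction_on with
  | _ n ih =>
    by_cases h : n < N + l
    · exact Finset.single_le_sum (f := fun i => |g i|) (fun i _ => abs_nonneg _)
        (Finset.mem_range.2 h)
    · have h1 := hg (n - l) (by omega)
      rw [Nat.sub_add_cancel (by omega)] at h1
      rw [h1]
      exact ih _ (by omega)

theorem IsPeriodFrom.sum_range_add_eq {x : ℕ → ℤ} {N l : ℕ} (h : IsPeriodFrom x N l) {n : ℕ}
    (hn : N ≤ n) : ∑ i ∈ Finset.range l, x (n + i) = ∑ i ∈ Finset.range l, x (N + i) := by
  induction n, hn using Nat.le_induction with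
  | base => rfl
  | succ n hn ih =>
    have h1 := Finset.sum_range_succ (fun i => x (n + i)) l
    have h2 := Finset.sum_range_succ' (fun i => x (n + i)) l
    have h3 : ∀ i, x (n + 1 + i) = x (n + (i + 1)) := fun i => by
      rw [add_assoc, add_comm 1 i]
    simp only [h3]
    have h4 := h.2 n hn
    simp only [add_zero] at h2
    rw [h2, h4] at h1
    rw [← ih]
    exact add_right_cancel h1

/-- After subtraction of the linear term the partial sums are themselves eventually periodic, hence
bounded. -/
theorem IsPeriodFrom.hasLinearGrowth_sum {x : ℕ → ℤ} {N l : ℕ} (h : IsPeriodFrom x N l) :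
    HasLinearGrowth (fun n => ∑ i ∈ Finset.range n, (x i : ℝ))
      ((∑ i ∈ Finset.range l, (x (N + i) : ℝ)) / l) := by
  have hl : (l : ℝ) ≠ 0 := by exact_mod_cast h.1.ne'
  refine exists_abs_le_of_eventually_periodic h.1 (N := N) fun n hn => ?_
  have h1 : ∑ i ∈ Finset.range l, (x (n + i) : ℝ) = ∑ i ∈ Finset.range l, (x (N + i) : ℝ) := by
    exact_mod_cast h.sum_range_add_eq hn
  simp only
  rw [Finset.sum_range_add, h1]
  push_cast
  field_simp
  ring

theorem sum_Icc_one_sub_one {M : Type*} [AddCommMonoid M] (f : ℕ → M) (n : ℕ) :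
    ∑ j ∈ Finset.Icc 1 n, f (j - 1) = ∑ i ∈ Finset.range n, f i := by
  induction n with
  | zero => simp
  | succ n ih => rw [Finset.sum_Icc_succ_top (by omega), ih, Finset.sum_range_succ]; simp

theorem EventuallyPeriodic.isPeriodFrom {x : ℕ → ℤ} (h : EventuallyPeriodic x) :
    IsPeriodFrom x (preperiodLength x) (periodLength x) := by
  obtain ⟨N, l, hN⟩ := h
  have h1 : periodLength x ∈ {l | ∃ N, IsPeriodFrom x N l} := Nat.sInf_mem ⟨l, N, hN⟩
  exact Nat.sInf_mem (s := {N | IsPeriodFrom x N (periodLength x)}) h1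

/-- The alternating sign has period 2, hence the passage to an even period. -/
theorem isPeriodFrom_alternating {z : ℝ} (h : EventuallyPeriodic (regCoeff z)) :
    IsPeriodFrom (fun j => (-1) ^ (j + 1) * regCoeff z j) (preperiodLength (regCoeff z))
      (evenPeriodLength z) := by
  have hp := h.isPeriodFrom
  have key : Even (evenPeriodLength z) ∧
      IsPeriodFrom (regCoeff z) (preperiodLength (regCoeff z)) (evenPeriodLength z) := by
    unfold evenPeriodLength
    split_ifs with he
    · exact ⟨he, hp⟩
    · refine ⟨even_two_mul _, by have := hp.1; omega, fun n hn => ?_⟩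
      rw [two_mul, ← add_assoc, hp.2 _ (by omega), hp.2 _ hn]
  refine ⟨key.2.1, fun n hn => ?_⟩
  simp only
  rw [key.2.2 n hn, add_right_comm, pow_add _ (n + 1), key.1.neg_one_pow, mul_one]

theorem hasLinearGrowth_regular {z : ℝ} (h : EventuallyPeriodic (regCoeff z)) :
    HasLinearGrowth
      (fun n => ∑ j ∈ Finset.range n, (((-1) ^ (j + 1) * regCoeff z j : ℤ) : ℝ))
      ((altSumB z : ℝ) / evenPeriodLength z) := by
  convert (isPeriodFrom_alternating h).hasLinearGrowth_sum using 2
  rw [altSumB, sum_Icc_one_sub_one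
    (fun i => (-1 : ℤ) ^ i * regCoeff z (preperiodLength (regCoeff z) + i)), Finset.mul_sum]
  push_cast
  exact Finset.sum_congr rfl fun i _ => by ring

theorem hasLinearGrowth_negative {z : ℝ} (h : EventuallyPeriodic (negCoeff z)) :
    HasLinearGrowth (fun n => ∑ j ∈ Finset.range n, ((3 - negCoeff z j : ℤ) : ℝ))
      (3 - (meanD z : ℝ)) := by
  have hp := h.isPeriodFrom
  have hp' : IsPeriodFrom (fun j => 3 - negCoeff z j) (preperiodLength (negCoeff z))
      (periodLength (negCoeff z)) := ⟨hp.1, fun n hn => by simp only [hp.2 n hn]⟩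
  have hl : (periodLength (negCoeff z) : ℝ) ≠ 0 := by exact_mod_cast hp.1.ne'
  convert hp'.hasLinearGrowth_sum using 1
  rw [meanD, sum_Icc_one_sub_one
    (fun i => (negCoeff z (preperiodLength (negCoeff z) + i) : ℚ))]
  push_cast
  rw [Finset.sum_sub_distrib, Finset.sum_const, Finset.card_range, nsmul_eq_mul, sub_div]
  field_simp

/-! ### Comparison of slopes and conclusion -/

theorem theorem2 (z : ℝ) (hz : IsQuadraticIrrational z) :
    -- both expansions are eventually periodic, so that `B` and `D` are meaningful
    (EventuallyPeriodic (regCoeff z) ∧ EventuallyPeriodic (negCoeff z)) ∧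
    -- the relation between `B` and `D`
    ((0 < altSumB z ↔ meanD z < 3) ∧
      (altSumB z = 0 ↔ meanD z = 3) ∧
      (altSumB z < 0 ↔ 3 < meanD z)) ∧
    -- the asymptotic behavior of the Dedekind sums
    ((0 < altSumB z ∨ meanD z < 3) →
      Filter.Tendsto (fun k => dedekindS (regNum z k) (regDen z k)) Filter.atTop Filter.atTop ∧
      Filter.Tendsto (fun j => dedekindS (negNum z j) (negDen z j)) Filter.atTop Filter.atTop) ∧
    ((altSumB z = 0 ∨ meanD z = 3) →
      (∃ C : ℝ, ∀ k, |dedekindS (regNum z k) (regDen z k)| ≤ C) ∧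
      (∃ C : ℝ, ∀ j, |dedekindS (negNum z j) (negDen z j)| ≤ C)) ∧
    ((altSumB z < 0 ∨ 3 < meanD z) →
      Filter.Tendsto (fun k => dedekindS (regNum z k) (regDen z k)) Filter.atTop Filter.atBot ∧
      Filter.Tendsto (fun j => dedekindS (negNum z j) (negDen z j)) Filter.atTop Filter.atBot) := by
  have hR := eventuallyPeriodic_regCoeff hz
  have hN := eventuallyPeriodic_negCoeff hz
  have gR := hasLinearGrowth_regular hR
  have gN := hasLinearGrowth_negative hN
  have hcmp : ∀ n, |(∑ j ∈ Finset.range (2 * (n + 1)), (((-1) ^ (j + 1) * regCoeff z j : ℤ) : ℝ))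
      - ∑ i ∈ Finset.range (negIndex z (n + 1)), ((3 - negCoeff z i : ℤ) : ℝ)| ≤ 1 := by
    intro n
    rw [← Int.cast_sum, ← Int.cast_sum, sum_range_negIndex_succ hz.1 n]
    push_cast
    simp
  have hφ : Filter.Tendsto (fun n : ℕ => 2 * (n + 1)) Filter.atTop Filter.atTop :=
    Filter.tendsto_atTop_mono (fun n => by rw [id_eq]; omega) Filter.tendsto_id
  have hψ : Filter.Tendsto (fun n => negIndex z (n + 1)) Filter.atTop Filter.atTop :=
    (strictMono_negIndex hz.1).tendsto_atTop.comp (Filter.tendsto_add_atTop_nat 1)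
  have hL : (0 : ℝ) < evenPeriodLength z := by exact_mod_cast (isPeriodFrom_alternating hR).1
  have hpos : 0 < altSumB z ↔ meanD z < 3 := by
    have := HasLinearGrowth.slope_pos_iff_of_comp gR gN hφ hψ hcmp
    rw [div_pos_iff_of_pos_right hL, sub_pos] at this
    exact_mod_cast this
  have hneg : altSumB z < 0 ↔ 3 < meanD z := by
    have := HasLinearGrowth.slope_neg_iff_of_comp gR gN hφ hψ hcmp
    rw [div_lt_iff₀ hL, zero_mul, sub_neg] at this
    exact_mod_cast this
  have hzero : altSumB z = 0 ↔ meanD z = 3 := by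
    rw [← not_iff_not, ← ne_eq, ← ne_eq, lt_or_lt_iff_ne.symm, lt_or_lt_iff_ne.symm, hneg, hpos,
      or_comm]
  -- The k-th Dedekind sum is compared with a sum of k + 1 terms, hence the index shift.
  have sR := gR.comp_succ.of_abs_sub_le (exists_abs_dedekindS_regNum_sub_le hz.1)
  have sN := gN.comp_succ.of_abs_sub_le (exists_abs_dedekindS_negNum_sub_le hz.1)
  refine ⟨⟨hR, hN⟩, ⟨hpos, hzero, hneg⟩, fun h => ?_, fun h => ?_, fun h => ?_⟩
  · have hB : 0 < altSumB z := h.elim id hpos.2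
    refine ⟨sR.tendsto_atTop (div_pos (by exact_mod_cast hB) hL), sN.tendsto_atTop (sub_pos.2 ?_)⟩
    exact_mod_cast hpos.1 hB
  · have hB : altSumB z = 0 := h.elim id hzero.2
    rw [hB, Int.cast_zero, zero_div] at sR
    rw [hzero.1 hB, Rat.cast_ofNat, sub_self] at sN
    exact ⟨sR.bounded, sN.bounded⟩
  · have hB : altSumB z < 0 := h.elim id hneg.2
    refine ⟨sR.tendsto_atBot (div_neg_of_neg_of_pos (by exact_mod_cast hB) hL),
      sN.tendsto_atBot (sub_neg.2 ?_)⟩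
    exact_mod_cast hneg.1 hB
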